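/- All topological groups are assumed to be Hausdorff. For topological abelian groups $G$ and $H$, an extension of $G$ by $H$ is a short exact sequence $E: 0\to H\xrightarrow{\imath} X\xrightarrow{\pi} G\to 0$ of topological abelian groups in which $\imath$ and $\pi$ are continuous homomorphisms that are open onto their images. Two extensions $E$, $E'$ of $G$ by $H$, with middle groups $X$ and $X'$, are equivalent if there is a continuous homomorphism $T:X\to X'$ with $T\circ\imath=\imath'$ and $\pi'\circ T=\pi$. Let $\mathrm{Ext}(G,H)$ be the set of equivalence classes of extensions of $G$ by $H$; it is an abelian group under the Baer sum $[E_1]+[E_2]=[\nabla_H((E_1\times E_2)\Delta_G)]$, where $\Delta_G(g)=(g,g)$, $\nabla_H(h,h')=h+h'$, and for continuous homomorphisms $t$ into the base (respectively out of the kernel) $Et$ (respectively $tE$) denotes the pull-back (respectively push-out) extension. Let $\varrho G$ be the completion of $G$ and $\mathcal I:G\to\varrho G$ the canonical inclusion. Theorem 3.2. Let $G$ and $H$ be topological abelian groups. If $H$ is \v{C}ech-complete (that is, a $G_\delta$-subset of its Stone--\v{C}ech compactification), then the map $$\phi:\mathrm{Ext}(\varrho G,H)\to \mathrm{Ext}(G,H),\qquad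 [E]\mapsto[E\mathcal I],$$ is an isomorphism of abelian groups. In particular $\mathrm{Ext}(G,H)\cong\mathrm{Ext}(\varrho G,H)$. -/

import Mathlib

open Topology

universe u v

/-- A topological space is Čech-complete if it is Tychonoff and it is a `G_δ`-subset of its
Stone–Čech compactification. -/
def IsCechComplete (X : Type u) [TopologicalSpace X] : Prop :=
  T35Space X ∧ IsGδ (Set.range (stoneCechUnit : X → StoneCech X))

section Completion

variable (G : Type u) [AddCommGroup G] [TopologicalSpace G] [IsTopologicalAddGroup G]

/-- The completion of a topological abelian group: the (Hausdorff) completion of the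
uniform space given by its canonical group uniformity. -/
def GroupCompletion : Type u :=
  @UniformSpace.Completion G (IsTopologicalAddGroup.rightUniformSpace G)

namespace GroupCompletion

noncomputable instance : AddCommGroup (GroupCompletion G) :=
  letI := IsTopologicalAddGroup.rightUniformSpace G
  haveI := isUniformAddGroup_of_addCommGroup (G := G)
  UniformSpace.Completion.instAddCommGroup (α := G)

noncomputable instance : UniformSpace (GroupCompletion G) :=
  @UniformSpace.Completion.uniformSpace G (IsTopologicalAddGroup.rightUniformSpace G)

instance : IsUniformAddGroup (GroupCompletion G) :=
  letI := IsTopologicalAddGroup.rightUniformSpace G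
  haveI := isUniformAddGroup_of_addCommGroup (G := G)
  UniformSpace.Completion.isUniformAddGroup (α := G)

instance : T2Space (GroupCompletion G) :=
  letI := IsTopologicalAddGroup.rightUniformSpace G
  (inferInstance : T2Space (UniformSpace.Completion G))

instance : CompleteSpace (GroupCompletion G) :=
  @UniformSpace.Completion.completeSpace G (IsTopologicalAddGroup.rightUniformSpace G)

/-- The canonical continuous homomorphism from a topological abelian group to its completion. -/
noncomputable def incl : G →ₜ+ GroupCompletion G :=
  letI := IsTopologicalAddGroup.rightUniformSpace G
  haveI := isUniformAddGroup_of_addCommGroup (G := G)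
  { toAddMonoidHom := (UniformSpace.Completion.toCompl : G →+ UniformSpace.Completion G)
    continuous_toFun := UniformSpace.Completion.continuous_toCompl }

end GroupCompletion

end Completion

/-- An extension `0 → H → X → G → 0` of (Hausdorff) topological abelian groups: a short exact
sequence whose maps are continuous and open onto their images. Since `X` is in bijection with
`H × G`, it may be taken in the universe `max u v`. -/
structure TopExtension (G : Type u) (H : Type v) [AddCommGroup G] [TopologicalSpace G]
    [AddCommGroup H] [TopologicalSpace H] where
  X : Type (max u v)
  [addCommGroup : AddCommGroup X]
  [topologicalSpace : TopologicalSpace X]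
  [isTopologicalAddGroup : IsTopologicalAddGroup X]
  [t2Space : T2Space X]
  ι : H →+ X
  π : X →+ G
  isSES : TopologicalAddGroup.IsSES ι π

attribute [instance] TopExtension.addCommGroup TopExtension.topologicalSpace
  TopExtension.isTopologicalAddGroup TopExtension.t2Space

/-- If the base is Hausdorff, an injective map which is open onto its image automatically has
closed range in a short exact sequence. -/
theorem isSES_of_isInducing {A B C : Type*} [AddCommGroup A] [AddCommGroup B] [AddCommGroup C]
    [TopologicalSpace A] [TopologicalSpace B] [TopologicalSpace C] [T1Space C]
    {i : A →+ B} {p : B →+ C} (hinj : Function.Injective i) (hi : IsInducing i)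
    (hp : IsOpenQuotientMap p) (h : Function.Exact i p) : TopologicalAddGroup.IsSES i p where
  isClosedEmbedding := ⟨⟨hi, hinj⟩, by
    have : Set.range i = p ⁻¹' {0} := by
      ext x; exact (h x).symm
    rw [this]
    exact isClosed_singleton.preimage hp.continuous⟩
  isOpenQuotientMap := hp
  exact := h

/-- The middle group of a short exact sequence with Hausdorff kernel is Hausdorff. -/
theorem t2Space_of_isSES {A B C : Type*} [AddCommGroup A] [AddCommGroup B] [AddCommGroup C]
    [TopologicalSpace A] [TopologicalSpace B] [TopologicalSpace C] [T1Space A]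
    [IsTopologicalAddGroup B]
    {i : A →+ B} {p : B →+ C} (h : TopologicalAddGroup.IsSES i p) : T2Space B := by
  rw [IsTopologicalAddGroup.t2Space_iff_zero_closed]
  have := h.isClosedEmbedding.isClosedMap {0} isClosed_singleton
  simpa using this

namespace TopExtension

section Basic

variable {G : Type u} {H : Type v} [AddCommGroup G] [TopologicalSpace G]
  [AddCommGroup H] [TopologicalSpace H]

/-- Two extensions are equivalent if there is a continuous homomorphism between the middle groups
which commutes with the maps from `H` and to `G`. -/
def Equivalent (E E' : TopExtension G H) : Prop :=
  ∃ T : E.X →ₜ+ E'.X, (∀ h, T (E.ι h) = E'.ι h) ∧ ∀ x, E'.π (T x) = E.π x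

theorem π_ι (E : TopExtension G H) (h : H) : E.π (E.ι h) = 0 :=
  (E.isSES.exact _).2 ⟨h, rfl⟩

theorem exists_ι (E : TopExtension G H) {x : E.X} (hx : E.π x = 0) : ∃ h, E.ι h = x :=
  (E.isSES.exact _).1 hx

theorem ι_injective (E : TopExtension G H) : Function.Injective E.ι :=
  E.isSES.isClosedEmbedding.injective

theorem ι_continuous (E : TopExtension G H) : Continuous E.ι :=
  E.isSES.isClosedEmbedding.continuous

theorem π_continuous (E : TopExtension G H) : Continuous E.π :=
  E.isSES.isOpenQuotientMap.continuous

theorem π_surjective (E : TopExtension G H) : Function.Surjective E.π :=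
  E.isSES.isOpenQuotientMap.surjective

theorem Equivalent.refl (E : TopExtension G H) : E.Equivalent E :=
  ⟨ContinuousAddMonoidHom.id _, fun _ => rfl, fun _ => rfl⟩

theorem Equivalent.trans {E E' E'' : TopExtension G H} (h : E.Equivalent E')
    (h' : E'.Equivalent E'') : E.Equivalent E'' := by
  obtain ⟨T, h1, h2⟩ := h
  obtain ⟨T', h1', h2'⟩ := h'
  refine ⟨T'.comp T, fun h => ?_, fun x => ?_⟩
  · change T' (T _) = _
    rw [h1, h1']
  · change E''.π (T' (T _)) = _
    rw [h2', h2]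

/-- A homomorphism witnessing an equivalence is automatically a topological isomorphism. -/
theorem Equivalent.symm {E E' : TopExtension G H} (h : E.Equivalent E') : E'.Equivalent E := by
  obtain ⟨T, h1, h2⟩ := h
  have hinj : Function.Injective T := by
    rw [injective_iff_map_eq_zero]
    intro x hx
    obtain ⟨h, rfl⟩ := E.exists_ι (x := x) (by rw [← h2, hx, map_zero])
    rw [h1] at hx
    rw [E'.ι_injective (hx.trans (map_zero _).symm), map_zero]
  have hsurj : Function.Surjective T := by
    intro y
    obtain ⟨x, hx⟩ := E.π_surjective (E'.π y)
    obtain ⟨h, hh⟩ := E'.exists_ι (x := y - T x) (by rw [map_sub, h2, hx, sub_self])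
    exact ⟨x + E.ι h, by rw [map_add, h1, hh]; abel⟩
  let e : E.X ≃+ E'.X := AddEquiv.ofBijective (T : E.X →+ E'.X) ⟨hinj, hsurj⟩
  have he : ∀ x, e x = T x := fun _ => rfl
  have hTe : ∀ y, T (e.symm y) = y := fun y => e.apply_symm_apply y
  have hcont : Continuous e.symm := by
    apply continuous_of_continuousAt_zero e.symm
    unfold ContinuousAt
    rw [map_zero]
    intro U hU
    obtain ⟨U₁, hU₁, hadd⟩ := exists_nhds_zero_half hU
    have hi : E.ι ⁻¹' U₁ ∈ 𝓝 (0 : H) :=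
      E.ι_continuous.continuousAt.preimage_mem_nhds (by rwa [map_zero])
    rw [E'.isSES.isClosedEmbedding.isInducing.nhds_eq_comap, map_zero] at hi
    obtain ⟨W, hW, hWU⟩ := hi
    obtain ⟨W₁, hW₁, hsub⟩ := exists_nhds_half_neg hW
    have hN : U₁ ∩ T ⁻¹' W₁ ∈ 𝓝 (0 : E.X) :=
      Filter.inter_mem hU₁ (T.continuous_toFun.continuousAt.preimage_mem_nhds
        (by change W₁ ∈ 𝓝 (T 0); rwa [map_zero]))
    have hN' := E.isSES.isOpenQuotientMap.isOpenMap.image_mem_nhds hN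
    rw [map_zero] at hN'
    have hV : W₁ ∩ E'.π ⁻¹' (E.π '' (U₁ ∩ T ⁻¹' W₁)) ∈ 𝓝 (0 : E'.X) :=
      Filter.inter_mem hW₁ (E'.π_continuous.continuousAt.preimage_mem_nhds
        (by rwa [map_zero]))
    rw [Filter.mem_map]
    refine Filter.mem_of_superset hV ?_
    rintro y ⟨hy, u, ⟨hu, hTu⟩, huy⟩
    obtain ⟨h, hh⟩ := E.exists_ι (x := e.symm y - u)
      (by rw [map_sub, ← h2, hTe, huy, sub_self])
    have : E'.ι h ∈ W := by
      rw [← h1, hh, map_sub, hTe]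
      exact hsub _ hy _ hTu
    have hmem : E.ι h ∈ U₁ := hWU this
    have := hadd _ hu _ hmem
    rw [hh] at this
    simpa using this
  refine ⟨{ toAddMonoidHom := e.symm.toAddMonoidHom, continuous_toFun := hcont },
    fun h => ?_, fun y => ?_⟩
  · change e.symm _ = _
    rw [e.symm_apply_eq, he, h1]
  · change E.π (e.symm y) = _
    rw [← h2, hTe]

variable (G H) in
/-- Equivalence of extensions is an equivalence relation. -/
def setoid : Setoid (TopExtension G H) where
  r := Equivalent
  iseqv := ⟨Equivalent.refl, Equivalent.symm, Equivalent.trans⟩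

end Basic

section Constructions

variable {G : Type u} {H : Type v} [AddCommGroup G] [TopologicalSpace G]
  [AddCommGroup H] [TopologicalSpace H]

section Trivial

variable [IsTopologicalAddGroup G] [T2Space G] [IsTopologicalAddGroup H] [T2Space H]

variable (G H) in
/-- The trivial extension `0 → H → H × G → G → 0`. -/
def trivial : TopExtension G H where
  X := H × G
  ι := AddMonoidHom.inl H G
  π := AddMonoidHom.snd H G
  isSES := by
    refine isSES_of_isInducing (fun a b h => (Prod.ext_iff.1 h).1) ?_
      ⟨Prod.snd_surjective, continuous_snd, isOpenMap_snd⟩ ?_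
    · exact IsInducing.of_comp (g := Prod.fst) (continuous_id.prodMk continuous_const) continuous_fst IsInducing.id
    · rintro ⟨h, g⟩
      constructor
      · rintro rfl
        exact ⟨h, rfl⟩
      · rintro ⟨h', hh⟩
        exact (Prod.ext_iff.1 hh).2.symm

end Trivial

section Neg

/-- The extension with the inclusion of the kernel replaced by its negative. -/
def neg (E : TopExtension G H) : TopExtension G H where
  X := E.X
  ι := -E.ι
  π := E.π
  isSES := by
    refine ⟨?_, E.isSES.isOpenQuotientMap, ?_⟩
    · exact (Homeomorph.neg E.X).isClosedEmbedding.comp E.isSES.isClosedEmbedding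
    · intro x
      constructor
      · intro hx
        obtain ⟨h, rfl⟩ := E.exists_ι hx
        exact ⟨-h, by simp⟩
      · rintro ⟨h, rfl⟩
        simp [E.π_ι]

end Neg

section Pullback

variable {Y : Type u} [AddCommGroup Y] [TopologicalSpace Y]

/-- The subgroup `{(x, y) | π x = t y}` of `X × Y`. -/
def pullbackSubgroup (E : TopExtension G H) (t : Y →ₜ+ G) : AddSubgroup (E.X × Y) :=
  (E.π.comp (AddMonoidHom.fst E.X Y)).eqLocus
    ((t : Y →+ G).comp (AddMonoidHom.snd E.X Y))

theorem mem_pullbackSubgroup {E : TopExtension G H} {t : Y →ₜ+ G} {z : E.X × Y} :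
    z ∈ E.pullbackSubgroup t ↔ E.π z.1 = t z.2 := Iff.rfl

variable [IsTopologicalAddGroup Y] [T2Space Y]

/-- The pull-back extension `E t` of an extension `E` of `G` along `t : Y → G`: its middle group is
`{(x, y) | π x = t y} ⊆ X × Y`. -/
def pullback (E : TopExtension G H) (t : Y →ₜ+ G) : TopExtension Y H where
  X := E.pullbackSubgroup t
  ι := ((AddMonoidHom.inl E.X Y).comp E.ι).codRestrict (E.pullbackSubgroup t)
    (fun h => by rw [mem_pullbackSubgroup]; simp [E.π_ι])
  π := (AddMonoidHom.snd E.X Y).comp (E.pullbackSubgroup t).subtype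
  isSES := by
    refine isSES_of_isInducing ?_ ?_ ⟨?_, ?_, ?_⟩ ?_
    · intro a b h
      exact E.ι_injective (Prod.ext_iff.1 (Subtype.ext_iff.1 h)).1
    · refine IsInducing.of_comp (g := fun z : E.pullbackSubgroup t => z.1.1) ?_ (by fun_prop)
        E.isSES.isClosedEmbedding.isInducing
      refine Continuous.subtype_mk (f := fun h => ((E.ι h, 0) : E.X × Y)) ?_ _
      exact E.ι_continuous.prodMk continuous_const
    · intro y
      obtain ⟨x, hx⟩ := E.π_surjective (t y)
      exact ⟨⟨(x, y), hx⟩, rfl⟩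
    · exact continuous_snd.comp continuous_subtype_val
    · apply IsTopologicalAddGroup.isOpenMap_iff_nhds_zero.2
      intro S hS
      rw [Filter.mem_map] at hS
      obtain ⟨V, hV, hVS⟩ := mem_nhds_subtype _ _ _ |>.1 hS
      change V ∈ 𝓝 ((0 : E.X), (0 : Y)) at hV
      rw [nhds_prod_eq, Filter.mem_prod_iff] at hV
      obtain ⟨A, hA, B, hB, hAB⟩ := hV
      have hA' := E.isSES.isOpenQuotientMap.isOpenMap.image_mem_nhds hA
      rw [map_zero] at hA'
      have hA'' : t ⁻¹' (E.π '' A) ∈ 𝓝 (0 : Y) :=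
        t.continuous_toFun.continuousAt.preimage_mem_nhds
          (by change _ ∈ 𝓝 (t 0); rwa [map_zero])
      refine Filter.mem_of_superset (Filter.inter_mem hA'' hB) ?_
      rintro y ⟨⟨a, ha, hay⟩, hy⟩
      exact hVS (a := ⟨(a, y), hay⟩) (hAB ⟨ha, hy⟩)
    · rintro ⟨⟨x, y⟩, hxy⟩
      rw [mem_pullbackSubgroup] at hxy
      constructor
      · intro hy
        change y = 0 at hy
        subst hy
        obtain ⟨h, rfl⟩ := E.exists_ι (x := x) (by simpa using hxy)
        exact ⟨h, rfl⟩
      · rintro ⟨h, hh⟩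
        exact (Prod.ext_iff.1 (Subtype.ext_iff.1 hh)).2.symm

/-- An extension of `Y` which maps to `E` over `t` and under `H` is the pull-back of `E`. -/
theorem equivalent_pullback {E : TopExtension G H} {t : Y →ₜ+ G} {F : TopExtension Y H}
    (T : F.X →ₜ+ E.X) (h1 : ∀ h, T (F.ι h) = E.ι h) (h2 : ∀ x, E.π (T x) = t (F.π x)) :
    F.Equivalent (E.pullback t) := by
  refine ⟨{ toAddMonoidHom := ((T : F.X →+ E.X).prod F.π).codRestrict
              (E.pullbackSubgroup t) h2
            continuous_toFun := ?_ }, ?_, ?_⟩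
  · exact Continuous.subtype_mk (T.continuous_toFun.prodMk F.π_continuous) _
  · intro h
    exact Subtype.ext (Prod.ext (h1 h) (F.π_ι h))
  · intro x
    rfl

theorem Equivalent.pullback {E E' : TopExtension G H} (h : E.Equivalent E') (t : Y →ₜ+ G) :
    (E.pullback t).Equivalent (E'.pullback t) := by
  obtain ⟨T, h1, h2⟩ := h
  refine equivalent_pullback
    (T.comp { toAddMonoidHom := (AddMonoidHom.fst E.X Y).comp (E.pullbackSubgroup t).subtype
              continuous_toFun := continuous_fst.comp continuous_subtype_val }) ?_ ?_
  · intro h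
    exact h1 h
  · intro x
    exact (h2 _).trans x.2

end Pullback

section Pushout

variable [T2Space G] {Y : Type v} [AddCommGroup Y] [TopologicalSpace Y] [IsTopologicalAddGroup Y]

/-- The subgroup `{(t h, -ι h) | h ∈ H}` of `Y × X`. -/
def pushoutSubgroup (E : TopExtension G H) (t : H →ₜ+ Y) : AddSubgroup (Y × E.X) :=
  ((t : H →+ Y).prod (-E.ι)).range

/-- The projection of the push-out to the base. -/
def pushoutπ (E : TopExtension G H) (t : H →ₜ+ Y) : (Y × E.X) ⧸ E.pushoutSubgroup t →+ G :=
  QuotientAddGroup.lift (E.pushoutSubgroup t) (E.π.comp (AddMonoidHom.snd Y E.X)) (by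
    rintro _ ⟨h, rfl⟩
    simp [E.π_ι])

/-- The inclusion of the kernel in the push-out. -/
def pushoutι (E : TopExtension G H) (t : H →ₜ+ Y) : Y →+ (Y × E.X) ⧸ E.pushoutSubgroup t :=
  (QuotientAddGroup.mk' (E.pushoutSubgroup t)).comp (AddMonoidHom.inl Y E.X)

theorem pushout_isSES (E : TopExtension G H) (t : H →ₜ+ Y) :
    TopologicalAddGroup.IsSES (E.pushoutι t) (E.pushoutπ t) := by
  have hker : ∀ y : Y, ∀ z : Y × E.X,
      E.pushoutι t y = (QuotientAddGroup.mk z : (Y × E.X) ⧸ E.pushoutSubgroup t) →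
      ∃ h, y = z.1 + t h ∧ z.2 = E.ι h := by
    intro y z h
    obtain ⟨k, hk⟩ := QuotientAddGroup.eq.1 h
    have e1 : t k = -y + z.1 := (Prod.ext_iff.1 hk).1
    have e2 : -E.ι k = -0 + z.2 := (Prod.ext_iff.1 hk).2
    refine ⟨-k, ?_, ?_⟩
    · rw [map_neg, e1]; abel
    · rw [map_neg, e2]; abel
  have hcont : Continuous (E.pushoutι t) :=
    QuotientAddGroup.continuous_mk.comp (continuous_id.prodMk continuous_const)
  refine isSES_of_isInducing ?_ ?_ ?_ ?_
  · rw [injective_iff_map_eq_zero]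
    intro y hy
    obtain ⟨h, h1, h2⟩ := hker y 0 hy
    have : h = 0 := E.ι_injective (h2.symm.trans (map_zero _).symm)
    simpa [this] using h1
  · apply IsTopologicalAddGroup.isInducing_iff_nhds_zero.2
    apply le_antisymm
    · have := hcont.tendsto 0
      rw [map_zero] at this
      exact this.le_comap
    · intro U hU
      obtain ⟨U₁, hU₁, hadd⟩ := exists_nhds_zero_half hU
      have ht : t ⁻¹' U₁ ∈ 𝓝 (0 : H) :=
        t.continuous_toFun.continuousAt.preimage_mem_nhds
          (by change _ ∈ 𝓝 (t 0); rwa [map_zero])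
      rw [E.isSES.isClosedEmbedding.isInducing.nhds_eq_comap, map_zero] at ht
      obtain ⟨W, hW, hWU⟩ := ht
      have hprod : U₁ ×ˢ W ∈ 𝓝 (0 : Y × E.X) := prod_mem_nhds hU₁ hW
      refine ⟨_, QuotientAddGroup.isOpenMap_coe.image_mem_nhds hprod, ?_⟩
      rintro y ⟨z, ⟨hz1, hz2⟩, hz⟩
      obtain ⟨h, rfl, h2⟩ := hker y z hz.symm
      exact hadd _ hz1 _ (hWU (by rwa [Set.mem_preimage, ← h2]))
  · have hq : IsOpenQuotientMap (QuotientAddGroup.mk : Y × E.X → _ ⧸ E.pushoutSubgroup t) :=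
      QuotientAddGroup.isOpenQuotientMap_mk
    have hsnd : IsOpenQuotientMap (Prod.snd : Y × E.X → E.X) :=
      ⟨Prod.snd_surjective, continuous_snd, isOpenMap_snd⟩
    exact (IsOpenQuotientMap.of_comp_iff hq).1 (E.isSES.isOpenQuotientMap.comp hsnd)
  · intro q
    obtain ⟨⟨y, x⟩, rfl⟩ := QuotientAddGroup.mk_surjective q
    constructor
    · intro hx
      obtain ⟨h, rfl⟩ := E.exists_ι (x := x) hx
      refine ⟨y + t h, ?_⟩
      refine QuotientAddGroup.eq.2 ⟨-h, ?_⟩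
      refine Prod.ext ?_ ?_
      · change t (-h) = -(y + t h) + y
        rw [map_neg]; abel
      · change -E.ι (-h) = -0 + E.ι h
        rw [map_neg]; abel
    · rintro ⟨y', hy'⟩
      rw [← hy']
      exact map_zero E.π

variable [T2Space Y]

/-- The push-out extension `t E` of an extension `E` by `H` along `t : H → Y`: its middle group is
the quotient of `Y × X` by `{(t h, -ι h) | h ∈ H}`. -/
def pushout (E : TopExtension G H) (t : H →ₜ+ Y) : TopExtension G Y :=
  haveI := t2Space_of_isSES (E.pushout_isSES t)
  { X := (Y × E.X) ⧸ E.pushoutSubgroup t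
    ι := E.pushoutι t
    π := E.pushoutπ t
    isSES := E.pushout_isSES t }

/-- The canonical map from the middle group of an extension to that of its push-out. -/
def toPushout (E : TopExtension G H) (t : H →ₜ+ Y) : E.X →ₜ+ (E.pushout t).X where
  toAddMonoidHom := (QuotientAddGroup.mk' (E.pushoutSubgroup t)).comp (AddMonoidHom.inr Y E.X)
  continuous_toFun := QuotientAddGroup.continuous_mk.comp (continuous_const.prodMk continuous_id)

theorem toPushout_ι (E : TopExtension G H) (t : H →ₜ+ Y) (h : H) :
    E.toPushout t (E.ι h) = (E.pushout t).ι (t h) := by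
  refine QuotientAddGroup.eq.2 ⟨h, ?_⟩
  refine Prod.ext ?_ ?_
  · change t h = -0 + t h
    abel
  · change -E.ι h = -E.ι h + 0
    abel

theorem π_toPushout (E : TopExtension G H) (t : H →ₜ+ Y) (x : E.X) :
    (E.pushout t).π (E.toPushout t x) = E.π x := rfl

/-- An extension by `Y` to which `E` maps under `t` and over `G` is the push-out of `E`. -/
theorem pushout_equivalent {E : TopExtension G H} {t : H →ₜ+ Y} {F : TopExtension G Y}
    (T : E.X →ₜ+ F.X) (h1 : ∀ h, T (E.ι h) = F.ι (t h)) (h2 : ∀ x, F.π (T x) = E.π x) :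
    (E.pushout t).Equivalent F := by
  let f : Y × E.X →+ F.X := F.ι.coprod (T : E.X →+ F.X)
  have hf : Continuous f :=
    (F.ι_continuous.comp continuous_fst).add (T.continuous_toFun.comp continuous_snd)
  have hker : E.pushoutSubgroup t ≤ f.ker := by
    rintro _ ⟨h, rfl⟩
    change F.ι (t h) + T (-E.ι h) = 0
    rw [map_neg, h1, add_neg_cancel]
  refine ⟨{ toAddMonoidHom := QuotientAddGroup.lift (E.pushoutSubgroup t) f hker
            continuous_toFun := hf.quotient_lift _ }, ?_, ?_⟩
  · intro y
    change F.ι y + T 0 = F.ι y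
    rw [map_zero, add_zero]
  · intro q
    obtain ⟨⟨y, x⟩, rfl⟩ := QuotientAddGroup.mk_surjective q
    change F.π (F.ι y + T x) = E.π x
    rw [map_add, F.π_ι, h2, zero_add]

theorem Equivalent.pushout {E E' : TopExtension G H} (h : E.Equivalent E') (t : H →ₜ+ Y) :
    (E.pushout t).Equivalent (E'.pushout t) := by
  obtain ⟨T, h1, h2⟩ := h
  refine pushout_equivalent ((E'.toPushout t).comp T) ?_ ?_
  · intro h
    change E'.toPushout t (T (E.ι h)) = _
    rw [h1, toPushout_ι]
  · intro x
    exact h2 x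

end Pushout

section Prod

variable {G' : Type u} {H' : Type v} [AddCommGroup G'] [TopologicalSpace G']
  [AddCommGroup H'] [TopologicalSpace H']

/-- The product of two extensions. -/
def prod (E : TopExtension G H) (E' : TopExtension G' H') : TopExtension (G × G') (H × H') where
  X := E.X × E'.X
  ι := E.ι.prodMap E'.ι
  π := E.π.prodMap E'.π
  isSES := by
    refine ⟨?_, E.isSES.isOpenQuotientMap.prodMap E'.isSES.isOpenQuotientMap, ?_⟩
    · exact E.isSES.isClosedEmbedding.prodMap E'.isSES.isClosedEmbedding
    · rintro ⟨x, x'⟩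
      constructor
      · intro hx
        obtain ⟨h, rfl⟩ := E.exists_ι (Prod.ext_iff.1 hx).1
        obtain ⟨h', rfl⟩ := E'.exists_ι (Prod.ext_iff.1 hx).2
        exact ⟨(h, h'), rfl⟩
      · rintro ⟨⟨h, h'⟩, hh⟩
        rw [← hh]
        exact Prod.ext (E.π_ι h) (E'.π_ι h')

theorem Equivalent.prod {E F : TopExtension G H} {E' F' : TopExtension G' H'}
    (h : E.Equivalent F) (h' : E'.Equivalent F') : (E.prod E').Equivalent (F.prod F') := by
  obtain ⟨T, h1, h2⟩ := h
  obtain ⟨T', h1', h2'⟩ := h'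
  refine ⟨{ toAddMonoidHom := (T : E.X →+ F.X).prodMap (T' : E'.X →+ F'.X)
            continuous_toFun := T.continuous_toFun.prodMap T'.continuous_toFun }, ?_, ?_⟩
  · rintro ⟨h, h'⟩
    exact Prod.ext (h1 h) (h1' h')
  · rintro ⟨x, x'⟩
    exact Prod.ext (h2 x) (h2' x')

end Prod

end Constructions

section Baer

variable {G : Type u} {H : Type v} [AddCommGroup G] [TopologicalSpace G]
  [IsTopologicalAddGroup G] [T2Space G]
  [AddCommGroup H] [TopologicalSpace H] [IsTopologicalAddGroup H] [T2Space H]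

variable (G) in
/-- The diagonal map `g ↦ (g, g)`. -/
def diagonal : G →ₜ+ G × G where
  toAddMonoidHom := (AddMonoidHom.id G).prod (AddMonoidHom.id G)
  continuous_toFun := continuous_id.prodMk continuous_id

variable (H) in
/-- The codiagonal map `(h, h') ↦ h + h'`. -/
def codiagonal : H × H →ₜ+ H where
  toAddMonoidHom := (AddMonoidHom.id H).coprod (AddMonoidHom.id H)
  continuous_toFun := continuous_fst.add continuous_snd

/-- The Baer sum `∇ ((E₁ × E₂) Δ)` of two extensions. -/
def baerSum (E₁ E₂ : TopExtension G H) : TopExtension G H :=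
  ((E₁.prod E₂).pullback (diagonal G)).pushout (codiagonal H)

theorem Equivalent.baerSum {E₁ F₁ E₂ F₂ : TopExtension G H} (h₁ : E₁.Equivalent F₁)
    (h₂ : E₂.Equivalent F₂) : (E₁.baerSum E₂).Equivalent (F₁.baerSum F₂) :=
  ((h₁.prod h₂).pullback _).pushout _

/-- The extension `(E₁ × E₂) Δ` of `G` by `H × H`. -/
def fiberProd (E₁ E₂ : TopExtension G H) : TopExtension G (H × H) :=
  (E₁.prod E₂).pullback (diagonal G)

/-- The first projection of the fiber product. -/
def fiberFst (E₁ E₂ : TopExtension G H) : (E₁.fiberProd E₂).X →ₜ+ E₁.X where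
  toAddMonoidHom := (AddMonoidHom.fst E₁.X E₂.X).comp ((AddMonoidHom.fst (E₁.X × E₂.X) G).comp
    ((E₁.prod E₂).pullbackSubgroup (diagonal G)).subtype)
  continuous_toFun := continuous_fst.comp (continuous_fst.comp continuous_subtype_val)

/-- The second projection of the fiber product. -/
def fiberSnd (E₁ E₂ : TopExtension G H) : (E₁.fiberProd E₂).X →ₜ+ E₂.X where
  toAddMonoidHom := (AddMonoidHom.snd E₁.X E₂.X).comp ((AddMonoidHom.fst (E₁.X × E₂.X) G).comp
    ((E₁.prod E₂).pullbackSubgroup (diagonal G)).subtype)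
  continuous_toFun := continuous_snd.comp (continuous_fst.comp continuous_subtype_val)

theorem π_fiberFst {E₁ E₂ : TopExtension G H} (x : (E₁.fiberProd E₂).X) :
    E₁.π (fiberFst E₁ E₂ x) = (E₁.fiberProd E₂).π x :=
  (Prod.ext_iff.1 x.2).1

theorem π_fiberSnd {E₁ E₂ : TopExtension G H} (x : (E₁.fiberProd E₂).X) :
    E₂.π (fiberSnd E₁ E₂ x) = (E₁.fiberProd E₂).π x :=
  (Prod.ext_iff.1 x.2).2

/-- Continuous homomorphisms into the fiber product. -/
def fiberLift {E₁ E₂ : TopExtension G H} {A : Type*} [AddCommGroup A] [TopologicalSpace A]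
    (f₁ : A →ₜ+ E₁.X) (f₂ : A →ₜ+ E₂.X) (h : ∀ a, E₂.π (f₂ a) = E₁.π (f₁ a)) :
    A →ₜ+ (E₁.fiberProd E₂).X where
  toAddMonoidHom := (((f₁ : A →+ E₁.X).prod (f₂ : A →+ E₂.X)).prod
    (E₁.π.comp (f₁ : A →+ E₁.X))).codRestrict ((E₁.prod E₂).pullbackSubgroup (diagonal G))
      (fun a => Prod.ext rfl (h a))
  continuous_toFun := Continuous.subtype_mk ((f₁.continuous_toFun.prodMk f₂.continuous_toFun).prodMk
    (E₁.π_continuous.comp f₁.continuous_toFun)) _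

theorem fiberLift_eq_ι {E₁ E₂ : TopExtension G H} {A : Type*} [AddCommGroup A]
    [TopologicalSpace A] {f₁ : A →ₜ+ E₁.X} {f₂ : A →ₜ+ E₂.X}
    {h : ∀ a, E₂.π (f₂ a) = E₁.π (f₁ a)} {a : A} {h₁ h₂ : H}
    (e₁ : f₁ a = E₁.ι h₁) (e₂ : f₂ a = E₂.ι h₂) :
    fiberLift f₁ f₂ h a = (E₁.fiberProd E₂).ι (h₁, h₂) := by
  refine Subtype.ext (Prod.ext (Prod.ext e₁ e₂) ?_)
  change E₁.π (f₁ a) = 0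
  rw [e₁, E₁.π_ι]

/-- The canonical map from the fiber product to the Baer sum. -/
def toBaerSum (E₁ E₂ : TopExtension G H) : (E₁.fiberProd E₂).X →ₜ+ (E₁.baerSum E₂).X :=
  (E₁.fiberProd E₂).toPushout (codiagonal H)

theorem toBaerSum_ι (E₁ E₂ : TopExtension G H) (h₁ h₂ : H) :
    toBaerSum E₁ E₂ ((E₁.fiberProd E₂).ι (h₁, h₂)) = (E₁.baerSum E₂).ι (h₁ + h₂) :=
  (E₁.fiberProd E₂).toPushout_ι (codiagonal H) (h₁, h₂)

theorem π_toBaerSum (E₁ E₂ : TopExtension G H) (x : (E₁.fiberProd E₂).X) :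
    (E₁.baerSum E₂).π (toBaerSum E₁ E₂ x) = (E₁.fiberProd E₂).π x := rfl

theorem baerSum_equivalent {E₁ E₂ F : TopExtension G H} (T : (E₁.fiberProd E₂).X →ₜ+ F.X)
    (h1 : ∀ h₁ h₂, T ((E₁.fiberProd E₂).ι (h₁, h₂)) = F.ι (h₁ + h₂))
    (h2 : ∀ x, F.π (T x) = (E₁.fiberProd E₂).π x) : (E₁.baerSum E₂).Equivalent F :=
  pushout_equivalent (t := codiagonal H) T (fun h => h1 h.1 h.2) h2

theorem baerSum_comm (E₁ E₂ : TopExtension G H) :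
    (E₁.baerSum E₂).Equivalent (E₂.baerSum E₁) := by
  refine baerSum_equivalent ((toBaerSum E₂ E₁).comp
    (fiberLift (fiberSnd E₁ E₂) (fiberFst E₁ E₂) fun x => by rw [π_fiberFst, π_fiberSnd])) ?_ ?_
  · intro h₁ h₂
    change toBaerSum E₂ E₁ (fiberLift _ _ _ _) = _
    rw [fiberLift_eq_ι (h₁ := h₂) (h₂ := h₁) rfl rfl, toBaerSum_ι, add_comm]
  · intro x
    exact π_fiberSnd x

theorem baerSum_trivial (E : TopExtension G H) :
    (E.baerSum (trivial G H)).Equivalent E := by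
  let q₁ : (E.fiberProd (trivial G H)).X →ₜ+ E.X := fiberFst E (trivial G H)
  let q₂ : (E.fiberProd (trivial G H)).X →ₜ+ H × G := fiberSnd E (trivial G H)
  refine baerSum_equivalent
    { toAddMonoidHom := (q₁ : _ →+ E.X) + E.ι.comp ((AddMonoidHom.fst H G).comp (q₂ : _ →+ H × G))
      continuous_toFun := q₁.continuous_toFun.add
        (E.ι_continuous.comp (continuous_fst.comp q₂.continuous_toFun)) } ?_ ?_
  · intro h₁ h₂
    exact (map_add E.ι h₁ h₂).symm
  · intro x
    change E.π (fiberFst E (trivial G H) x + E.ι _) = _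
    rw [map_add, E.π_ι, add_zero, π_fiberFst]

theorem neg_baerSum (E : TopExtension G H) :
    (E.neg.baerSum E).Equivalent (trivial G H) := by
  let P := E.neg.fiberProd E
  let q₁ : P.X →ₜ+ E.X := fiberFst E.neg E
  let q₂ : P.X →ₜ+ E.X := fiberSnd E.neg E
  let d : P.X →+ E.X := (q₂ : P.X →+ E.X) - (q₁ : P.X →+ E.X)
  have hd : Continuous d := q₂.continuous_toFun.sub q₁.continuous_toFun
  have hd0 : ∀ x, E.π (d x) = 0 := by
    intro x
    change E.π (q₂ x - q₁ x) = 0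
    rw [map_sub, sub_eq_zero]
    exact (π_fiberSnd x).trans (π_fiberFst (E₁ := E.neg) x).symm
  choose k hk using fun x => E.exists_ι (hd0 x)
  have hkc : Continuous k := by
    rw [E.isSES.isClosedEmbedding.isInducing.continuous_iff]
    exact hd.congr fun x => (hk x).symm
  let k' : P.X →+ H :=
    AddMonoidHom.mk' k fun a b => E.ι_injective (by rw [map_add, hk, hk, hk, map_add])
  refine baerSum_equivalent
    { toAddMonoidHom := k'.prod P.π
      continuous_toFun := hkc.prodMk P.π_continuous } ?_ ?_
  · intro h₁ h₂
    refine Prod.ext (E.ι_injective ((hk _).trans ?_)) (P.π_ι (h₁, h₂))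
    change E.ι h₂ - -E.ι h₁ = E.ι (h₁ + h₂)
    rw [map_add]; abel
  · intro x
    rfl

theorem baerSum_assoc (E₁ E₂ E₃ : TopExtension G H) :
    ((E₁.baerSum E₂).baerSum E₃).Equivalent (E₁.baerSum (E₂.baerSum E₃)) := by
  let Δ : G →ₜ+ (G × G) × G :=
    { toAddMonoidHom := ((AddMonoidHom.id G).prod (AddMonoidHom.id G)).prod (AddMonoidHom.id G)
      continuous_toFun := (continuous_id.prodMk continuous_id).prodMk continuous_id }
  let c : (H × H) × H →ₜ+ H :=
    { toAddMonoidHom :=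
        ((AddMonoidHom.id H).coprod (AddMonoidHom.id H)).coprod (AddMonoidHom.id H)
      continuous_toFun := ((continuous_fst.comp continuous_fst).add
        (continuous_snd.comp continuous_fst)).add continuous_snd }
  let P : TopExtension G ((H × H) × H) := ((E₁.prod E₂).prod E₃).pullback Δ
  let j : P.X →ₜ+ (E₁.X × E₂.X) × E₃.X :=
    { toAddMonoidHom := (AddMonoidHom.fst ((E₁.X × E₂.X) × E₃.X) G).comp
        (((E₁.prod E₂).prod E₃).pullbackSubgroup Δ).subtype
      continuous_toFun := continuous_fst.comp continuous_subtype_val }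
  let p₁ : P.X →ₜ+ E₁.X :=
    { toAddMonoidHom := (AddMonoidHom.fst E₁.X E₂.X).comp
        ((AddMonoidHom.fst (E₁.X × E₂.X) E₃.X).comp (j : P.X →+ _))
      continuous_toFun := continuous_fst.comp (continuous_fst.comp j.continuous_toFun) }
  let p₂ : P.X →ₜ+ E₂.X :=
    { toAddMonoidHom := (AddMonoidHom.snd E₁.X E₂.X).comp
        ((AddMonoidHom.fst (E₁.X × E₂.X) E₃.X).comp (j : P.X →+ _))
      continuous_toFun := continuous_snd.comp (continuous_fst.comp j.continuous_toFun) }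
  let p₃ : P.X →ₜ+ E₃.X :=
    { toAddMonoidHom := (AddMonoidHom.snd (E₁.X × E₂.X) E₃.X).comp (j : P.X →+ _)
      continuous_toFun := continuous_snd.comp j.continuous_toFun }
  have hp₁ : ∀ x, E₁.π (p₁ x) = P.π x := fun x => (Prod.ext_iff.1 (Prod.ext_iff.1 x.2).1).1
  have hp₂ : ∀ x, E₂.π (p₂ x) = P.π x := fun x => (Prod.ext_iff.1 (Prod.ext_iff.1 x.2).1).2
  have hp₃ : ∀ x, E₃.π (p₃ x) = P.π x := fun x => (Prod.ext_iff.1 x.2).2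
  let f₁₂ : P.X →ₜ+ (E₁.baerSum E₂).X :=
    (toBaerSum E₁ E₂).comp (fiberLift p₁ p₂ fun x => (hp₂ x).trans (hp₁ x).symm)
  let f₂₃ : P.X →ₜ+ (E₂.baerSum E₃).X :=
    (toBaerSum E₂ E₃).comp (fiberLift p₂ p₃ fun x => (hp₃ x).trans (hp₂ x).symm)
  have h₁₂ : ∀ a b d, f₁₂ (P.ι ((a, b), d)) = (E₁.baerSum E₂).ι (a + b) := by
    intro a b d
    change toBaerSum E₁ E₂ (fiberLift _ _ _ _) = _
    rw [fiberLift_eq_ι (h₁ := a) (h₂ := b) rfl rfl, toBaerSum_ι]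
  have h₂₃ : ∀ a b d, f₂₃ (P.ι ((a, b), d)) = (E₂.baerSum E₃).ι (b + d) := by
    intro a b d
    change toBaerSum E₂ E₃ (fiberLift _ _ _ _) = _
    rw [fiberLift_eq_ι (h₁ := b) (h₂ := d) rfl rfl, toBaerSum_ι]
  have hπ₁₂ : ∀ x, (E₁.baerSum E₂).π (f₁₂ x) = P.π x := hp₁
  have hπ₂₃ : ∀ x, (E₂.baerSum E₃).π (f₂₃ x) = P.π x := hp₂
  have A : (P.pushout c).Equivalent ((E₁.baerSum E₂).baerSum E₃) := by
    refine pushout_equivalent ((toBaerSum _ _).comp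
      (fiberLift f₁₂ p₃ fun x => (hp₃ x).trans (hπ₁₂ x).symm)) ?_ hπ₁₂
    rintro ⟨⟨a, b⟩, d⟩
    change toBaerSum _ _ (fiberLift _ _ _ _) = _
    rw [fiberLift_eq_ι (h₁ := a + b) (h₂ := d) (h₁₂ a b d) rfl, toBaerSum_ι]
    rfl
  have B : (P.pushout c).Equivalent (E₁.baerSum (E₂.baerSum E₃)) := by
    refine pushout_equivalent ((toBaerSum _ _).comp
      (fiberLift p₁ f₂₃ fun x => (hπ₂₃ x).trans (hp₁ x).symm)) ?_ hp₁
    rintro ⟨⟨a, b⟩, d⟩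
    change toBaerSum _ _ (fiberLift _ _ _ _) = _
    rw [fiberLift_eq_ι (h₁ := a) (h₂ := b + d) rfl (h₂₃ a b d), toBaerSum_ι, ← add_assoc]
    rfl
  exact A.symm.trans B

theorem Equivalent.neg {E F : TopExtension G H} (h : E.Equivalent F) :
    E.neg.Equivalent F.neg := by
  obtain ⟨T, h1, h2⟩ := h
  refine ⟨T, fun h => ?_, h2⟩
  change T (-E.ι h) = -F.ι h
  rw [map_neg, h1]

end Baer

end TopExtension

section Ext

variable (G : Type u) (H : Type v) [AddCommGroup G] [TopologicalSpace G]
  [AddCommGroup H] [TopologicalSpace H]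

/-- `Ext(G, H)`: the set of equivalence classes of extensions `0 → H → X → G → 0` of topological
abelian groups. -/
def TopExt : Type (max u v + 1) :=
  Quotient (TopExtension.setoid G H)

end Ext

namespace TopExt

open TopExtension

section

variable {G : Type u} {H : Type v} [AddCommGroup G] [TopologicalSpace G]
  [AddCommGroup H] [TopologicalSpace H]

/-- The class of an extension. -/
def mk (E : TopExtension G H) : TopExt G H :=
  Quotient.mk (TopExtension.setoid G H) E

theorem mk_eq_mk {E F : TopExtension G H} : mk E = mk F ↔ E.Equivalent F :=
  Quotient.eq (r := TopExtension.setoid G H)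

theorem ind {p : TopExt G H → Prop} (h : ∀ E, p (mk E)) (e : TopExt G H) : p e :=
  Quotient.ind h e

/-- The map `[E] ↦ [E t]` induced by pull-back along `t : Y → G`. -/
def pullback {Y : Type u} [AddCommGroup Y] [TopologicalSpace Y] [IsTopologicalAddGroup Y]
    [T2Space Y] (t : Y →ₜ+ G) : TopExt G H → TopExt Y H :=
  Quotient.map (fun E => E.pullback t) (fun _ _ h => Equivalent.pullback h t)

end

variable {G : Type u} {H : Type v} [AddCommGroup G] [TopologicalSpace G]
  [IsTopologicalAddGroup G] [T2Space G]
  [AddCommGroup H] [TopologicalSpace H] [IsTopologicalAddGroup H] [T2Space H]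

/-- Zero in `Ext(G, H)` is the class of the trivial extension. -/
instance : Zero (TopExt G H) := ⟨mk (TopExtension.trivial G H)⟩

/-- Addition in `Ext(G, H)` is induced by the Baer sum. -/
instance : Add (TopExt G H) :=
  ⟨Quotient.map₂ baerSum (fun _ _ h₁ _ _ h₂ => Equivalent.baerSum h₁ h₂)⟩

instance : Neg (TopExt G H) :=
  ⟨Quotient.map TopExtension.neg (fun _ _ h => Equivalent.neg h)⟩

theorem mk_add_mk (E F : TopExtension G H) : mk E + mk F = mk (E.baerSum F) := rfl

/-- `Ext(G, H)` is an abelian group. -/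
instance : AddCommGroup (TopExt G H) where
  nsmul := nsmulRec
  zsmul := zsmulRec
  add_assoc := by
    intro a b c
    induction a using ind with | _ E₁
    induction b using ind with | _ E₂
    induction c using ind with | _ E₃
    exact mk_eq_mk.2 (baerSum_assoc E₁ E₂ E₃)
  add_comm := by
    intro a b
    induction a using ind with | _ E₁
    induction b using ind with | _ E₂
    exact mk_eq_mk.2 (baerSum_comm E₁ E₂)
  add_zero := by
    intro a
    induction a using ind with | _ E
    exact mk_eq_mk.2 (baerSum_trivial E)
  zero_add := by
    intro a
    induction a using ind with | _ E
    exact mk_eq_mk.2 ((baerSum_comm _ E).trans (baerSum_trivial E))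
  neg_add_cancel := by
    intro a
    induction a using ind with | _ E
    exact mk_eq_mk.2 (neg_baerSum E)

end TopExt

/-!
Pulling extensions back along a dense subgroup of the base is additive for the Baer sum. If `H` is
complete, a retraction of the pulled-back middle group onto `H` extends by uniform continuity to the
whole middle group, so only trivial extensions become trivial. Conversely, completing the middle
group of an extension by `H` gives an extension of the completed base as soon as the quotient of the
completed middle group by `H` is complete. That holds when `H` is feathered: a Cauchy filter on the
quotient lifts to an ultrafilter whose spread along `H` is controlled by the neighbourhoods of a
compact subset of `H` of countable character. A Čech-complete group is feathered, by compactness of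
`StoneCech H`, and complete, since its image in its completion is a dense `G_δ` subgroup and Baire's
theorem makes it meet all of its cosets.
-/

open Filter Set Pointwise

theorem exists_seq_mem_filter {X : Type*} {F : Filter X} {p : ℕ → Set X → Set X → Prop}
    (h : ∀ n, ∀ U ∈ F, ∃ V ∈ F, p n U V) :
    ∃ V : ℕ → Set X, (∀ n, V n ∈ F) ∧ ∀ n, p n (V n) (V (n + 1)) := by
  choose next hmem hnext using h
  let V : ℕ → {U : Set X // U ∈ F} :=
    fun n => Nat.rec ⟨univ, univ_mem⟩ (fun n U => ⟨next n U U.2, hmem n U U.2⟩) n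
  exact ⟨fun n => (V n).1, fun n => (V n).2, fun n => hnext n _ (V n).2⟩

section Cauchy

variable {Y : Type*} [AddCommGroup Y] [UniformSpace Y] [IsUniformAddGroup Y] {f : Filter Y}

theorem cauchy_iff_exists_sub_subset :
    Cauchy f ↔ f.NeBot ∧ ∀ U ∈ 𝓝 (0 : Y), ∃ S ∈ f, S - S ⊆ U := by
  simp only [((𝓝 (0 : Y)).basis_sets.uniformity_of_nhds_zero).cauchy_iff, sub_subset_iff]
  exact and_congr_right fun _ => forall₂_congr fun _ _ => exists_congr fun _ =>
    and_congr_right fun _ => ⟨fun h x hx y hy => h y hy x hx, fun h x hx y hy => h y hy x hx⟩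

theorem exists_mem_vadd_mem_of_cauchy (hf : Cauchy f) {T : Set Y} (hT : T ∈ f) {U : Set Y}
    (hU : U ∈ 𝓝 0) : ∃ x ∈ T, x +ᵥ U ∈ f := by
  obtain ⟨hne, hsub⟩ := cauchy_iff_exists_sub_subset.1 hf
  obtain ⟨S, hS, hSU⟩ := hsub U hU
  obtain ⟨x, hxT, hxS⟩ := hne.nonempty_of_mem (inter_mem hT hS)
  exact ⟨x, hxT, mem_of_superset hS fun y hy => mem_vadd_set.2
    ⟨y - x, hSU (sub_mem_sub hy hxS), add_sub_cancel x y⟩⟩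

theorem cauchy_of_forall_exists_vadd_mem [f.NeBot] (h : ∀ U ∈ 𝓝 (0 : Y), ∃ x : Y, x +ᵥ U ∈ f) :
    Cauchy f := by
  refine cauchy_iff_exists_sub_subset.2 ⟨inferInstance, fun U hU => ?_⟩
  obtain ⟨W, hW, hWU⟩ := exists_nhds_half_neg hU
  obtain ⟨x, hx⟩ := h W hW
  refine ⟨_, hx, sub_subset_iff.2 ?_⟩
  rintro _ ⟨a, ha, rfl⟩ _ ⟨b, hb, rfl⟩
  simpa using hWU a ha b hb

end Cauchy

/-- A topological group is *feathered* if it has a nonempty compact subset with a countable base of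
neighbourhoods. It is the condition on a kernel that makes quotients of complete groups complete. -/
def IsFeathered (H : Type*) [TopologicalSpace H] : Prop :=
  ∃ K : Set H, K.Nonempty ∧ IsCompact K ∧ (𝓝ˢ K).IsCountablyGenerated

section Feathered

variable {H : Type*} [AddCommGroup H] [TopologicalSpace H]

theorem IsFeathered.exists_nhds_zero_seq_subset_add [IsTopologicalAddGroup H]
    (hH : IsFeathered H) : ∃ V : ℕ → Set H, (∀ n, V n ∈ 𝓝 0) ∧
      ∀ U ∈ 𝓝 (0 : H), ∃ n, ∃ A : Set H, A.Finite ∧ V n ⊆ A + U := by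
  obtain ⟨K, ⟨k, hk⟩, hK, _⟩ := hH
  obtain ⟨B, hB⟩ := (𝓝ˢ K).exists_antitone_basis
  have hBk : ∀ n, B n ∈ 𝓝 k := fun n => nhds_le_nhdsSet hk (hB.mem n)
  refine ⟨fun n => (k + ·) ⁻¹' B n, fun n => (continuous_const_add k).continuousAt.preimage_mem_nhds
    (by simpa using hBk n), fun U hU => ?_⟩
  obtain ⟨t, -, hKt⟩ := hK.elim_nhds_subcover (fun a => a +ᵥ interior U) fun a _ => by
    simpa using vadd_mem_nhds_vadd a (interior_mem_nhds.2 hU)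
  have hopen : IsOpen ((t : Set H) + interior U) := isOpen_interior.add_left
  have hKt' : K ⊆ (t : Set H) + interior U :=
    hKt.trans (iUnion₂_subset fun a ha => vadd_set_subset_add ha)
  obtain ⟨n, hn⟩ := hB.mem_iff.1 (hopen.mem_nhdsSet.2 hKt')
  refine ⟨n, (-k + ·) '' t, t.finite_toSet.image _, fun x hx => ?_⟩
  obtain ⟨a, ha, u, hu, hau⟩ := mem_add.1 (hn hx)
  exact mem_add.2 ⟨-k + a, mem_image_of_mem _ ha, u, interior_subset hu, by
    rw [add_assoc, hau, neg_add_cancel_left]⟩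

variable {Y : Type*} [AddCommGroup Y] [TopologicalSpace Y] [IsTopologicalAddGroup Y]

theorem exists_nhds_zero_seq_add_subset (P : ℕ → Set Y) (hP : ∀ n, P n ∈ 𝓝 0) :
    ∃ W : ℕ → Set Y, (∀ n, W n ∈ 𝓝 0 ∧ W n ⊆ P n ∧ -W n = W n) ∧
      ∀ n, W (n + 1) + W (n + 1) ⊆ W n := by
  obtain ⟨W, hW, hWP⟩ := exists_seq_mem_filter (F := 𝓝 (0 : Y))
    (p := fun n U W => (W ⊆ P n ∧ -W = W) ∧ W + W ⊆ U) fun n U hU => by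
      obtain ⟨W, hW, -, hneg, hadd⟩ :=
        exists_closed_nhds_zero_neg_eq_add_subset (inter_mem hU (hP n))
      have hWUP := (subset_add_left W (mem_of_mem_nhds hW)).trans hadd
      exact ⟨W, hW, ⟨hWUP.trans inter_subset_right, hneg⟩, hadd.trans inter_subset_left⟩
  exact ⟨fun n => W (n + 1), fun n => ⟨hW _, (hWP n).1⟩, fun n => (hWP (n + 1)).2⟩

theorem IsFeathered.exists_nhds_zero_seq_inter_range_subset_add [IsTopologicalAddGroup H]
    (hH : IsFeathered H) {i : H →+ Y} (hi : IsInducing i) :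
    ∃ W : ℕ → Set Y, (∀ n, W n ∈ 𝓝 0 ∧ -W n = W n) ∧ (∀ n, W (n + 1) + W (n + 1) ⊆ W n) ∧
      ∀ U ∈ 𝓝 (0 : Y), ∃ n, ∃ A : Set Y, A.Finite ∧ W n ∩ range i ⊆ A + U := by
  have hnhds : 𝓝 (0 : H) = comap i (𝓝 0) := by rw [hi.nhds_eq_comap, map_zero]
  obtain ⟨V, hV, hVU⟩ := hH.exists_nhds_zero_seq_subset_add
  choose P hP hPV using fun n => mem_comap.1 (hnhds ▸ hV n)
  obtain ⟨W, hW, hadd⟩ := exists_nhds_zero_seq_add_subset P hP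
  refine ⟨W, fun n => ⟨(hW n).1, (hW n).2.2⟩, hadd, fun U hU => ?_⟩
  obtain ⟨n, A, hA, hVA⟩ := hVU _ (hnhds ▸ preimage_mem_comap hU)
  refine ⟨n, i '' A, hA.image i, ?_⟩
  rintro _ ⟨hh, h, rfl⟩
  obtain ⟨a, ha, u, hu, rfl⟩ := mem_add.1 (hVA (hPV n ((hW n).2.1 hh)))
  exact mem_add.2 ⟨i a, mem_image_of_mem i ha, i u, hu, (map_add i a u).symm⟩

end Feathered

section Quotient

variable {Y Q : Type*} [AddCommGroup Y] [AddCommGroup Q] [UniformSpace Q] [IsUniformAddGroup Q]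
  {q : Y →+ Q}

theorem exists_antitone_vadd_image_mem [TopologicalSpace Y] (hq : IsOpenQuotientMap q)
    {f : Filter Q} (hf : Cauchy f) {W : ℕ → Set Y} (hW : ∀ n, W n ∈ 𝓝 0)
    (hadd : ∀ n, W (n + 1) + W (n + 1) ⊆ W n) :
    ∃ y : ℕ → Y, Antitone (fun n => y n +ᵥ W n) ∧ ∀ n, q '' (y n +ᵥ W n) ∈ f := by
  have lift : ∀ (n : ℕ) (T : Set Y), q '' T ∈ f → ∃ y ∈ T, q '' (y +ᵥ W n) ∈ f := by
    intro n T hT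
    have hqW : q '' W n ∈ 𝓝 0 := by simpa using hq.isOpenMap.image_mem_nhds (hW n)
    obtain ⟨_, ⟨y, hy, rfl⟩, hyf⟩ := exists_mem_vadd_mem_of_cauchy hf hT hqW
    exact ⟨y, hy, by rwa [image_vadd_distrib]⟩
  -- `y n` is chosen with the smaller translate `y n +ᵥ W (n + 1)` meeting `f`, so that the next
  -- point can be taken inside that translate.
  have step : ∀ (n : ℕ) (y : {y : Y // q '' (y +ᵥ W (n + 1)) ∈ f}),
      ∃ y' : {y : Y // q '' (y +ᵥ W (n + 2)) ∈ f}, y'.1 +ᵥ W (n + 1) ⊆ y.1 +ᵥ W n := by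
    rintro n ⟨y, hy⟩
    obtain ⟨_, ⟨w, hw, rfl⟩, hy'⟩ := lift (n + 2) _ hy
    refine ⟨⟨y +ᵥ w, hy'⟩, ?_⟩
    rw [vadd_assoc, vadd_set_subset_vadd_set_iff]
    exact (vadd_set_subset_add hw).trans (hadd n)
  choose next hnext using step
  obtain ⟨y₀, -, hy₀⟩ := lift 1 univ (by simp [hq.surjective.range_eq])
  let y : ∀ n, {y : Y // q '' (y +ᵥ W (n + 1)) ∈ f} := fun n => Nat.rec ⟨y₀, hy₀⟩ next n
  refine ⟨fun n => (y n).1, antitone_nat_of_succ_le fun n => hnext n (y n), fun n => ?_⟩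
  have hWn : W (n + 1) ⊆ W n :=
    (subset_add_left _ (mem_of_mem_nhds (hW (n + 1)))).trans (hadd n)
  exact mem_of_superset (y n).2 (image_mono (vadd_set_mono hWn))

theorem cauchy_of_cauchy_map [UniformSpace Y] [IsUniformAddGroup Y] (hq : IsOpenMap q)
    {F : Ultrafilter Y} (hF : Cauchy (map q F))
    (hker : ∀ U ∈ 𝓝 (0 : Y), ∃ S ∈ F, ∃ M ∈ 𝓝 (0 : Y), ∃ A : Set Y, A.Finite ∧
      (S - S - M) ∩ q.ker ⊆ A + U) : Cauchy (F : Filter Y) := by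
  refine cauchy_of_forall_exists_vadd_mem fun U hU => ?_
  obtain ⟨U₁, hU₁, hadd⟩ := exists_nhds_zero_half hU
  obtain ⟨S, hS, M, hM, A, hA, hSMA⟩ := hker U₁ hU₁
  have hqU : q '' (U₁ ∩ M) ∈ 𝓝 0 := by simpa using hq.image_mem_nhds (inter_mem hU₁ hM)
  obtain ⟨_, ⟨z, hz, rfl⟩, hzF⟩ := exists_mem_vadd_mem_of_cauchy hF (image_mem_map hS) hqU
  have hcover : (⋃ a ∈ A, (z + a) +ᵥ U) ∈ F := by
    refine mem_of_superset (inter_mem hS hzF) ?_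
    rintro x ⟨hx, _, ⟨w, ⟨hwU, hwM⟩, rfl⟩, hxw⟩
    have hxzw : x - z - w ∈ (S - S - M) ∩ q.ker := by
      refine ⟨sub_mem_sub (sub_mem_sub hx hz) hwM, ?_⟩
      simp only [SetLike.mem_coe, AddMonoidHom.mem_ker, map_sub, ← hxw, vadd_eq_add]
      abel
    obtain ⟨a, ha, u, hu, hau⟩ := mem_add.1 (hSMA hxzw)
    refine mem_iUnion₂.2 ⟨a, ha, mem_vadd_set.2 ⟨u + w, hadd u hu w hwU, ?_⟩⟩
    rw [vadd_eq_add, add_assoc, ← add_assoc a, hau]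
    abel
  obtain ⟨a, -, ha⟩ := (Ultrafilter.finite_biUnion_mem_iff hA).1 hcover
  exact ⟨z + a, ha⟩

theorem IsFeathered.completeSpace_of_exact {H : Type*} [AddCommGroup H] [TopologicalSpace H]
    [IsTopologicalAddGroup H] (hH : IsFeathered H) [UniformSpace Y] [IsUniformAddGroup Y]
    [CompleteSpace Y] {i : H →+ Y} (hi : IsInducing i) (hq : IsOpenQuotientMap q)
    (hiq : Function.Exact i q) : CompleteSpace Q := by
  obtain ⟨W, hW, hadd, hWU⟩ := hH.exists_nhds_zero_seq_inter_range_subset_add hi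
  have hsub : ∀ n, W (n + 1) - W (n + 1) ⊆ W n := fun n => by
    rw [sub_eq_add_neg, (hW (n + 1)).2]
    exact hadd n
  refine ⟨fun {f} hf => ?_⟩
  obtain ⟨y, hy, hyf⟩ := exists_antitone_vadd_image_mem hq hf (fun n => (hW n).1) hadd
  have hne : (comap q f ⊓ ⨅ n, 𝓟 (y n +ᵥ W n)).NeBot := by
    rw [(f.basis_sets.comap q).inf_basis_neBot_iff (hasBasis_iInf_principal hy.directed_ge)]
    rintro T hT n -
    obtain ⟨_, hxT, x, hx, rfl⟩ := hf.1.nonempty_of_mem (inter_mem hT (hyf n))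
    exact ⟨x, hxT, hx⟩
  obtain ⟨F, hF⟩ := Ultrafilter.exists_le (comap q f ⊓ ⨅ n, 𝓟 (y n +ᵥ W n))
  have hFf : Tendsto q F f := tendsto_iff_comap.2 (hF.trans inf_le_left)
  have hFy : ∀ n, y n +ᵥ W n ∈ F := fun n =>
    (hF.trans inf_le_right) (mem_iInf_of_mem n (mem_principal_self _))
  have hFc : Cauchy (F : Filter Y) := by
    refine cauchy_of_cauchy_map hq.isOpenMap (hf.mono hFf) fun U hU => ?_
    obtain ⟨n, A, hA, hAU⟩ := hWU U hU
    refine ⟨_, hFy (n + 2), _, (hW (n + 1)).1, A, hA, fun x hx => hAU ⟨?_, (hiq x).1 hx.2⟩⟩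
    obtain ⟨_, ⟨_, ⟨a, ha, rfl⟩, _, ⟨b, hb, rfl⟩, rfl⟩, c, hc, rfl⟩ := hx.1
    have hab : a - b ∈ W (n + 1) := hsub (n + 1) (sub_mem_sub ha hb)
    simpa using hsub n (sub_mem_sub hab hc)
  obtain ⟨l, hl⟩ := CompleteSpace.complete hFc
  exact ⟨q l, le_nhds_of_cauchy_adhp hf <|
    (ClusterPt.of_le_nhds ((map_mono hl).trans hq.continuous.continuousAt)).mono hFf⟩

end Quotient

section CechComplete

theorem exists_isCompact_subset_isCountablyGenerated_nhdsSet {Z : Type*} [TopologicalSpace Z]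
    [CompactSpace Z] [RegularSpace Z] {S : Set Z} (hS : IsGδ S) {z : Z} (hz : z ∈ S) :
    ∃ K ⊆ S, z ∈ K ∧ IsCompact K ∧ (𝓝ˢ K).IsCountablyGenerated := by
  obtain ⟨O, hO, rfl⟩ := hS.eq_iInter_nat
  obtain ⟨V, hV, hVO⟩ := exists_seq_mem_filter (F := 𝓝 z)
    (p := fun n U V => IsClosed V ∧ V ⊆ interior U ∩ O n) fun n U hU =>
      have hUO := inter_mem (interior_mem_nhds.2 hU) ((hO n).mem_nhds (mem_iInter.1 hz n))
      let ⟨V, hV, hVc, hVU⟩ := exists_mem_nhds_isClosed_subset hUO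
      ⟨V, hV, hVc, hVU⟩
  let C : ℕ → Set Z := fun n => V (n + 1)
  have hCc : ∀ n, IsClosed (C n) := fun n => (hVO n).1
  have hCint : ∀ n, C (n + 1) ⊆ interior (C n) := fun n => (hVO (n + 1)).2.trans inter_subset_left
  have hanti : Antitone C := antitone_nat_of_succ_le fun n => (hCint n).trans interior_subset
  have hbasis : (𝓝ˢ (⋂ n, C n)).HasBasis (fun _ => True) C := ⟨fun U => by
    simp only [true_and]
    refine ⟨fun hU => exists_subset_nhds_of_compactSpace hanti.directed_ge hCc
      (mem_nhdsSet_iff_forall.1 hU), fun ⟨n, hn⟩ => mem_of_superset ?_ hn⟩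
    exact mem_nhdsSet_iff_exists.2 ⟨interior (C n), isOpen_interior,
      (iInter_subset C (n + 1)).trans (hCint n), interior_subset⟩⟩
  exact ⟨⋂ n, C n, iInter_mono fun n => (hVO n).2.trans inter_subset_right,
    mem_iInter.2 fun n => mem_of_mem_nhds (hV (n + 1)), (isClosed_iInter hCc).isCompact,
    hbasis.isCountablyGenerated⟩

theorem IsCechComplete.isFeathered {H : Type*} [TopologicalSpace H] [Nonempty H]
    (hH : IsCechComplete H) : IsFeathered H := by
  have := hH.1
  obtain ⟨K, hK, hxK, hKc, _⟩ := exists_isCompact_subset_isCountablyGenerated_nhdsSet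
    hH.2 (mem_range_self (Classical.arbitrary H))
  refine ⟨stoneCechUnit ⁻¹' K, ⟨_, hxK⟩, isInducing_stoneCechUnit.isCompact_preimage' hKc hK, ?_⟩
  rw [isInducing_stoneCechUnit.nhdsSet_eq_comap, image_preimage_eq_of_subset hK]
  infer_instance

theorem eq_of_map_eq_of_isDenseInducing {X A K : Type*} [TopologicalSpace X] [TopologicalSpace A]
    [T2Space A] [TopologicalSpace K] {e : X → A} (he : IsDenseInducing e) {j : X → K}
    (hj : IsInducing j) {f : A → K} (hf : Continuous f) (hfe : f ∘ e = j) {a : A} {x : X}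
    (ha : f a = j x) : a = e x := by
  have : (comap e (𝓝 a)).NeBot := he.comap_nhds_neBot a
  have hx : comap e (𝓝 a) ≤ 𝓝 x := by
    rw [hj.nhds_eq_comap, ← ha, ← hfe, ← comap_comap]
    exact comap_mono (hf.tendsto a).le_comap
  exact tendsto_nhds_unique tendsto_comap ((he.continuous.tendsto x).mono_left hx)

theorem IsCechComplete.isGδ_range_of_compactSpace {H K : Type*} [TopologicalSpace H]
    [TopologicalSpace K] [CompactSpace K] [T2Space K] (hH : IsCechComplete H) {j : H → K}
    (hj : IsDenseInducing j) : IsGδ (range j) := by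
  have := hH.1
  obtain ⟨O, hO, hrange⟩ := hH.2.eq_iInter_nat
  let f : StoneCech H → K := stoneCechExtend hj.continuous
  have hf : Continuous f := continuous_stoneCechExtend hj.continuous
  have hfe : f ∘ stoneCechUnit = j := stoneCechExtend_extends hj.continuous
  have hsurj : Function.Surjective f := by
    have hfd : DenseRange f := .of_comp (g := stoneCechUnit) (hfe ▸ hj.dense)
    rw [← range_eq_univ, ← hfd.closure_range, hf.isClosedMap.isClosed_range.closure_eq]
  -- The remainder of `StoneCech H` is mapped onto the remainder of `K`, a countable union of
  -- compact sets.
  have hrem : ∀ p ∉ range stoneCechUnit, f p ∉ range j := by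
    rintro p hp ⟨h, hh⟩
    exact hp ⟨h, (eq_of_map_eq_of_isDenseInducing isDenseInducing_stoneCechUnit hj.isInducing hf
      hfe hh.symm).symm⟩
  have hj_range : range j = ⋂ n, (f '' (O n)ᶜ)ᶜ := by
    rw [← compl_iUnion, ← image_iUnion, ← compl_iInter, ← hrange]
    refine Subset.antisymm (fun k hk ⟨p, hp, hpk⟩ => hrem p hp (hpk ▸ hk)) fun k hk => ?_
    obtain ⟨p, rfl⟩ := hsurj k
    obtain ⟨h, rfl⟩ : p ∈ range stoneCechUnit := by_contra fun hp => hk ⟨p, hp, rfl⟩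
    exact ⟨h, (congrFun hfe h).symm⟩
  rw [hj_range]
  exact .iInter_of_isOpen fun n => ((hO n).isClosed_compl.isCompact.image hf).isClosed.isOpen_compl

theorem IsCechComplete.isGδ_range {H C : Type*} [TopologicalSpace H] [TopologicalSpace C]
    [T35Space C] (hH : IsCechComplete H) {j : H → C} (hj : IsDenseInducing j) :
    IsGδ (range j) := by
  have hunit := hH.isGδ_range_of_compactSpace
    ⟨isInducing_stoneCechUnit.comp hj.isInducing,
      denseRange_stoneCechUnit.comp hj.dense continuous_stoneCechUnit⟩
  rw [← preimage_image_eq (range j) injective_stoneCechUnit_of_t35Space, ← range_comp]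
  exact hunit.preimage continuous_stoneCechUnit

theorem IsCechComplete.baireSpace {H : Type*} [TopologicalSpace H] (hH : IsCechComplete H) :
    BaireSpace H := by
  have := hH.1
  have := hH.2.baireSpace_of_dense denseRange_stoneCechUnit
  exact (isEmbedding_stoneCechUnit (X := H)).toHomeomorph.symm.baireSpace

theorem dense_preimage_of_isDenseInducing {X Z : Type*} [TopologicalSpace X] [TopologicalSpace Z]
    {e : X → Z} (he : IsDenseInducing e) {S : Set Z} (hS : IsOpen S) (hSd : Dense S) :
    Dense (e ⁻¹' S) := by
  rw [he.isInducing.dense_iff, image_preimage_eq_inter_range]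
  exact fun x => hSd.inter_of_isOpen_left he.dense hS (e x)

theorem IsCechComplete.completeSpace {H : Type*} [AddCommGroup H] [UniformSpace H]
    [IsUniformAddGroup H] (hH : IsCechComplete H) : CompleteSpace H := by
  have := hH.1
  have := hH.baireSpace
  let C := UniformSpace.Completion H
  let j : H →+ C := UniformSpace.Completion.toCompl
  have hj : IsDenseInducing j := UniformSpace.Completion.isDenseInducing_toCompl H
  have : T35Space C := {}
  obtain ⟨W, hW, hWr⟩ := (hH.isGδ_range hj).eq_iInter_nat
  have hWd : ∀ n, Dense (W n) := fun n => hj.dense.mono (hWr ▸ iInter_subset W n)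
  -- By Baire's theorem the dense `G_δ` sets `range j` and `y - range j` meet, so `y ∈ range j`.
  have hsurj : Function.Surjective j := by
    intro y
    obtain ⟨h, hh⟩ : (⋂ n, {h | y - j h ∈ W n}).Nonempty := Dense.nonempty <|
      dense_iInter_of_isOpen_nat
        (fun n => (hW n).preimage (continuous_const.sub hj.continuous))
        fun n => dense_preimage_of_isDenseInducing hj
          ((hW n).preimage (Homeomorph.subLeft y).continuous)
          ((hWd n).preimage (Homeomorph.subLeft y).isOpenMap)
    obtain ⟨k, hk⟩ : y - j h ∈ range j := by
      rw [hWr]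
      exact mem_iInter.2 fun n => mem_iInter.1 hh n
    exact ⟨k + h, by rw [map_add, hk, sub_add_cancel]⟩
  have hju : IsUniformInducing j := UniformSpace.Completion.isUniformInducing_coe H
  exact (hju.completeSpace_congr hsurj).2 inferInstance

end CechComplete

section Completion

variable {A B C : Type*} [AddCommGroup A] [TopologicalSpace A] [IsTopologicalAddGroup A]
  [AddCommGroup B] [TopologicalSpace B] [IsTopologicalAddGroup B]
  [AddCommGroup C] [UniformSpace C] [IsUniformAddGroup C] [CompleteSpace C] [T2Space C]

theorem exists_continuousAddMonoidHom_extension {j : A →+ B} (hj : IsDenseInducing j) {f : A →+ C}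
    (hf : Continuous f) : ∃ g : B →ₜ+ C, ∀ a, g (j a) = f a := by
  let := IsTopologicalAddGroup.rightUniformSpace A
  have := isUniformAddGroup_of_addCommGroup (G := A)
  let := IsTopologicalAddGroup.rightUniformSpace B
  have := isUniformAddGroup_of_addCommGroup (G := B)
  have hju := AddMonoidHom.isUniformInducing_of_isInducing hj.isInducing
  have hfu : UniformContinuous f := uniformContinuous_addMonoidHom_of_continuous hf
  let g : B → C := hj.extend f
  have hg : Continuous g := (uniformContinuous_uniformly_extend hju hj.dense hfu).continuous
  have hgj : ∀ a, g (j a) = f a := hj.extend_eq hf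
  have hadd : ∀ x y, g (x + y) = g x + g y := fun x y =>
    hj.dense.induction_on₂ (p := fun x y => g (x + y) = g x + g y)
      (isClosed_eq (by fun_prop) (by fun_prop))
      (fun a b => by rw [← map_add, hgj, hgj, hgj, map_add]) x y
  exact ⟨{ toAddMonoidHom := AddMonoidHom.mk' g hadd, continuous_toFun := hg }, hgj⟩

theorem isHomeomorph_of_comp_isDenseInducing [T2Space B] {s : A →+ C} (hs : Continuous s)
    (hsd : DenseRange s) {p : C →+ B} (hp : Continuous p) (hps : IsDenseInducing (p.comp s)) :
    IsHomeomorph p := by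
  obtain ⟨r, hr⟩ := exists_continuousAddMonoidHom_extension hps hs
  have hrc : Continuous r := r.continuous_toFun
  have hrp : r ∘ p = id := hsd.equalizer (hrc.comp hp) continuous_id (funext hr)
  have hpr : p ∘ r = id :=
    hps.dense.equalizer (hp.comp hrc) continuous_id (funext fun a => congrArg p (hr a))
  exact isHomeomorph_iff_exists_inverse.2 ⟨hp, r, congrFun hrp, congrFun hpr, hrc⟩

end Completion

section ShortExactSequence

variable {H X G Z K : Type*} [AddCommGroup H] [UniformSpace H] [IsUniformAddGroup H]
  [CompleteSpace H] [T0Space H] [AddCommGroup X] [TopologicalSpace X]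
  [AddCommGroup G] [TopologicalSpace G] [IsTopologicalAddGroup G]
  [AddCommGroup Z] [UniformSpace Z] [IsUniformAddGroup Z] [CompleteSpace Z] [T2Space Z]
  [AddCommGroup K] [TopologicalSpace K] [IsTopologicalAddGroup K] [T2Space K]

theorem IsFeathered.isSES_of_isDenseInducing (hH : IsFeathered H)
    {ι : H →+ X} {π : X →+ G} (hE : TopologicalAddGroup.IsSES ι π)
    {j : X →+ Z} (hj : IsDenseInducing j) {k : G →+ K} (hk : IsDenseInducing k)
    {p : Z →+ K} (hp : Continuous p) (hpj : ∀ x, p (j x) = k (π x)) :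
    TopologicalAddGroup.IsSES (j.comp ι) p := by
  let i : H →+ Z := j.comp ι
  have hi : IsInducing i := hj.isInducing.comp hE.isClosedEmbedding.isInducing
  let Q := Z ⧸ i.range
  let := IsTopologicalAddGroup.rightUniformSpace Q
  have := isUniformAddGroup_of_addCommGroup (G := Q)
  let q : Z →+ Q := QuotientAddGroup.mk' i.range
  have hq : IsOpenQuotientMap q := QuotientAddGroup.isOpenQuotientMap_mk
  have hiq : Function.Exact i q := fun z => QuotientAddGroup.eq_zero_iff z
  have hclosed : IsClosed (i.range : Set Z) :=
    (AddMonoidHom.isUniformInducing_of_isInducing hi).isComplete_range.isClosed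
  have : T3Space Q := inferInstance
  have : CompleteSpace Q := hH.completeSpace_of_exact hi hq hiq
  let p' : Q →+ K := QuotientAddGroup.lift i.range p <| by
    rintro _ ⟨h, rfl⟩
    change p (j (ι h)) = 0
    rw [hpj, (hE.exact _).2 ⟨h, rfl⟩, map_zero]
  let s : G →+ Q := π.liftOfSurjective hE.isOpenQuotientMap.surjective ⟨q.comp j, fun x hx => by
    obtain ⟨h, rfl⟩ := (hE.exact x).1 hx
    exact (hiq _).2 ⟨h, rfl⟩⟩
  have hsπ : s ∘ π = q ∘ j := funext <| AddMonoidHom.liftOfRightInverse_comp_apply _ _ _ _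
  have hs : Continuous s := by
    rw [hE.isOpenQuotientMap.isQuotientMap.continuous_iff, hsπ]
    exact hq.continuous.comp hj.continuous
  have hsd : DenseRange s := .of_comp (g := π) <|
    hsπ ▸ hq.surjective.denseRange.comp hj.dense hq.continuous
  have hp's : p'.comp s = k := by
    ext g
    obtain ⟨x, rfl⟩ := hE.isOpenQuotientMap.surjective g
    exact (congrArg p' (congrFun hsπ x)).trans (hpj x)
  have hp' : IsHomeomorph p' :=
    isHomeomorph_of_comp_isDenseInducing hs hsd (hp.quotient_lift _) (hp's ▸ hk)
  refine isSES_of_isInducing hi.injective hi (hp'.homeomorph.isOpenQuotientMap.comp hq) fun z => ?_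
  exact (map_eq_zero_iff p' hp'.injective).trans (hiq z)

end ShortExactSequence

namespace GroupCompletion

theorem isDenseInducing_incl (G : Type u) [AddCommGroup G] [TopologicalSpace G]
    [IsTopologicalAddGroup G] : IsDenseInducing (incl G : G →+ GroupCompletion G) :=
  let := IsTopologicalAddGroup.rightUniformSpace G
  have := isUniformAddGroup_of_addCommGroup (G := G)
  UniformSpace.Completion.isDenseInducing_toCompl G

end GroupCompletion

namespace TopExtension

variable {G Y : Type u} {H : Type v} [AddCommGroup G] [TopologicalSpace G]
  [AddCommGroup Y] [TopologicalSpace Y] [IsTopologicalAddGroup Y] [T2Space Y] [AddCommGroup H]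

section Pullback

variable [TopologicalSpace H]

/-- The projection of the middle group `{(x, y) | π x = t y}` of a pull-back to that of the
extension. -/
def fromPullback (E : TopExtension G H) (t : Y →ₜ+ G) : (E.pullback t).X →ₜ+ E.X where
  toAddMonoidHom := (AddMonoidHom.fst E.X Y).comp (E.pullbackSubgroup t).subtype
  continuous_toFun := continuous_fst.comp continuous_subtype_val

/-- The homomorphism into the middle group `{(x, y) | π x = t y}` of a pull-back with given
coordinates. -/
def pullbackLift (E : TopExtension G H) (t : Y →ₜ+ G) {A : Type*} [AddCommGroup A]
    [TopologicalSpace A] (f : A →ₜ+ E.X) (g : A →+ Y) (hg : Continuous g)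
    (h : ∀ a, E.π (f a) = t (g a)) : A →ₜ+ (E.pullback t).X where
  toAddMonoidHom := ((f : A →+ E.X).prod g).codRestrict (E.pullbackSubgroup t) h
  continuous_toFun := (f.continuous_toFun.prodMk hg).subtype_mk _

theorem π_fromPullback (E : TopExtension G H) (t : Y →ₜ+ G) (x : (E.pullback t).X) :
    E.π (E.fromPullback t x) = t ((E.pullback t).π x) := x.2

theorem isDenseInducing_fromPullback (E : TopExtension G H) {t : Y →ₜ+ G}
    (ht : IsDenseInducing t) :
    IsDenseInducing (E.fromPullback t : (E.pullback t).X →+ E.X) := by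
  constructor
  · let Φ : E.pullbackSubgroup t → E.X × G := Prod.map id t ∘ Subtype.val
    have hΦ : IsInducing Φ := (IsInducing.id.prodMap ht.isInducing).comp .subtypeVal
    have hΦ' : Φ = (fun x => (x, E.π x)) ∘ E.fromPullback t :=
      funext fun z => Prod.ext rfl z.2.symm
    exact .of_comp (E.fromPullback t).continuous_toFun (continuous_id.prodMk E.π_continuous)
      (hΦ' ▸ hΦ)
  · refine (ht.dense.preimage E.isSES.isOpenQuotientMap.isOpenMap).mono ?_
    rintro x ⟨y, hy⟩
    exact ⟨⟨(x, y), hy.symm⟩, rfl⟩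

theorem pullback_comp_equivalent {K : Type u} [AddCommGroup K] [TopologicalSpace K]
    [IsTopologicalAddGroup G] [T2Space G] (E : TopExtension K H) (s : G →ₜ+ K) (t : Y →ₜ+ G) :
    (E.pullback (s.comp t)).Equivalent ((E.pullback s).pullback t) := by
  let E' := E.pullback (s.comp t)
  let T : E'.X →ₜ+ (E.pullback s).X :=
    E.pullbackLift s (E.fromPullback (s.comp t)) ((t : Y →+ G).comp E'.π)
      (t.continuous_toFun.comp E'.π_continuous) (E.π_fromPullback (s.comp t))
  exact equivalent_pullback T
    (fun h => Subtype.ext (Prod.ext rfl ((congrArg t (E'.π_ι h)).trans (map_zero t)))) fun _ => rfl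

theorem baerSum_pullback [IsTopologicalAddGroup G] [T2Space G] [IsTopologicalAddGroup H]
    [T2Space H] (E₁ E₂ : TopExtension G H) (t : Y →ₜ+ G) :
    ((E₁.pullback t).baerSum (E₂.pullback t)).Equivalent ((E₁.baerSum E₂).pullback t) := by
  let P := (E₁.pullback t).fiberProd (E₂.pullback t)
  let q₁ : P.X →ₜ+ E₁.X := (E₁.fromPullback t).comp (fiberFst _ _)
  let q₂ : P.X →ₜ+ E₂.X := (E₂.fromPullback t).comp (fiberSnd _ _)
  have hq₁ : ∀ x, E₁.π (q₁ x) = t (P.π x) := fun x =>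
    (E₁.π_fromPullback t _).trans (congrArg t (π_fiberFst x))
  have hq₂ : ∀ x, E₂.π (q₂ x) = t (P.π x) := fun x =>
    (E₂.π_fromPullback t _).trans (congrArg t (π_fiberSnd x))
  let q : P.X →ₜ+ (E₁.baerSum E₂).X :=
    (toBaerSum E₁ E₂).comp (fiberLift q₁ q₂ fun x => (hq₂ x).trans (hq₁ x).symm)
  have hqι : ∀ a b, q (P.ι (a, b)) = (E₁.baerSum E₂).ι (a + b) := fun a b => by
    change toBaerSum E₁ E₂ (fiberLift q₁ q₂ _ _) = _
    rw [fiberLift_eq_ι (h₁ := a) (h₂ := b) rfl rfl, toBaerSum_ι]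
  exact baerSum_equivalent ((E₁.baerSum E₂).pullbackLift t q P.π P.π_continuous hq₁)
    (fun a b => Subtype.ext (Prod.ext (hqι a b) (P.π_ι (a, b)))) fun _ => rfl

end Pullback

section Complete

variable [UniformSpace H] [IsUniformAddGroup H] [CompleteSpace H] [T2Space H]

theorem equivalent_trivial_of_pullback [IsTopologicalAddGroup G] [T2Space G]
    (E : TopExtension G H) {t : Y →ₜ+ G} (ht : IsDenseInducing t)
    (h : (E.pullback t).Equivalent (trivial Y H)) : E.Equivalent (trivial G H) := by
  obtain ⟨T, hTι, -⟩ := h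
  let T' : (E.pullback t).X →ₜ+ H × Y := T
  obtain ⟨r, hr⟩ := exists_continuousAddMonoidHom_extension (E.isDenseInducing_fromPullback ht)
    (f := (AddMonoidHom.fst H Y).comp (T' : (E.pullback t).X →+ H × Y))
    (continuous_fst.comp T'.continuous_toFun)
  have hrι : ∀ h, r (E.ι h) = h := fun h =>
    (hr ((E.pullback t).ι h)).trans (congrArg Prod.fst (hTι h))
  exact ⟨{ toAddMonoidHom := (r : E.X →+ H).prod E.π
           continuous_toFun := r.continuous_toFun.prodMk E.π_continuous },
    fun h => Prod.ext (hrι h) (E.π_ι h), fun _ => rfl⟩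

theorem exists_pullback_equivalent {K : Type u} [AddCommGroup K] [UniformSpace K]
    [IsUniformAddGroup K] [CompleteSpace K] [T2Space K] (hH : IsFeathered H)
    (E : TopExtension Y H) {t : Y →ₜ+ K} (ht : IsDenseInducing t) :
    ∃ F : TopExtension K H, E.Equivalent (F.pullback t) := by
  let j := GroupCompletion.incl E.X
  have hj : IsDenseInducing (j : E.X →+ GroupCompletion E.X) :=
    GroupCompletion.isDenseInducing_incl E.X
  let k : Y →+ K := t
  obtain ⟨p, hp⟩ := exists_continuousAddMonoidHom_extension hj (f := k.comp E.π)
    (t.continuous_toFun.comp E.π_continuous)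
  let F : TopExtension K H :=
    { X := GroupCompletion E.X
      ι := (j : E.X →+ GroupCompletion E.X).comp E.ι
      π := p
      isSES := hH.isSES_of_isDenseInducing E.isSES hj (k := k) ht (p := p) p.continuous_toFun hp }
  exact ⟨F, equivalent_pullback (E := F) j (fun _ => rfl) hp⟩

end Complete

end TopExtension

namespace TopExt

variable {G Y : Type u} {H : Type v} [AddCommGroup G] [TopologicalSpace G]
  [IsTopologicalAddGroup G] [T2Space G]
  [AddCommGroup Y] [TopologicalSpace Y] [IsTopologicalAddGroup Y] [T2Space Y] [AddCommGroup H]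

/-- Pull-back of extension classes, as a homomorphism for the Baer sum. -/
def pullbackHom [TopologicalSpace H] [IsTopologicalAddGroup H] [T2Space H] (t : Y →ₜ+ G) :
    TopExt G H →+ TopExt Y H :=
  AddMonoidHom.mk' (pullback t) fun a b => by
    induction a using TopExt.ind with | _ E₁
    induction b using TopExt.ind with | _ E₂
    exact (mk_eq_mk.2 (E₁.baerSum_pullback E₂ t)).symm

variable [UniformSpace H] [IsUniformAddGroup H] [CompleteSpace H] [T2Space H]

theorem pullbackHom_injective {t : Y →ₜ+ G} (ht : IsDenseInducing t) :
    Function.Injective (pullbackHom t : TopExt G H →+ TopExt Y H) := by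
  rw [injective_iff_map_eq_zero]
  intro a ha
  induction a using TopExt.ind with | _ E
  exact mk_eq_mk.2 (E.equivalent_trivial_of_pullback ht (mk_eq_mk.1 ha))

theorem pullbackHom_surjective (hH : IsFeathered H) {t : Y →ₜ+ G} (ht : IsDenseInducing t) :
    Function.Surjective (pullbackHom t : TopExt G H →+ TopExt Y H) := by
  intro a
  induction a using TopExt.ind with | _ E
  let j := GroupCompletion.incl G
  have hj : IsDenseInducing j := GroupCompletion.isDenseInducing_incl G
  have hjt : IsDenseInducing (j.comp t) :=
    ⟨hj.isInducing.comp ht.isInducing, hj.dense.comp ht.dense hj.continuous⟩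
  obtain ⟨F, hF⟩ := E.exists_pullback_equivalent hH hjt
  exact ⟨mk (F.pullback j), (mk_eq_mk.2 (hF.trans (F.pullback_comp_equivalent j t))).symm⟩

end TopExt

theorem theorem3p2_general {G Y : Type u} {H : Type v}
    [AddCommGroup G] [TopologicalSpace G] [IsTopologicalAddGroup G] [T2Space G]
    [AddCommGroup Y] [TopologicalSpace Y] [IsTopologicalAddGroup Y] [T2Space Y]
    [AddCommGroup H] [TopologicalSpace H] [IsTopologicalAddGroup H] [T2Space H]
    (hH : IsCechComplete H) {t : Y →ₜ+ G} (ht : IsDenseInducing t) :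
    ∃ φ : TopExt G H ≃+ TopExt Y H, ∀ e, φ e = TopExt.pullback t e := by
  let := IsTopologicalAddGroup.rightUniformSpace H
  have := isUniformAddGroup_of_addCommGroup (G := H)
  have := hH.completeSpace
  exact ⟨AddEquiv.ofBijective (TopExt.pullbackHom t)
    ⟨TopExt.pullbackHom_injective ht, TopExt.pullbackHom_surjective hH.isFeathered ht⟩,
    fun _ => rfl⟩

theorem theorem3p2 (G : Type u) (H : Type v)
    [AddCommGroup G] [TopologicalSpace G] [IsTopologicalAddGroup G] [T2Space G]
    [AddCommGroup H] [TopologicalSpace H] [IsTopologicalAddGroup H] [T2Space H]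
    (hH : IsCechComplete H) :
    ∃ φ : TopExt (GroupCompletion G) H ≃+ TopExt G H,
      ∀ e, φ e = TopExt.pullback (GroupCompletion.incl G) e :=
  theorem3p2_general hH (GroupCompletion.isDenseInducing_incl G)
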